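/- For an integer $n\ge 1$ let $[n]^2$ carry the coordinatewise order: for distinct $x,y\in[n]^2$ write $x\prec y$ if $x_1\le y_1$ and $x_2\le y_2$. A function $f\colon[n]^2\to\mathbb{R}$ is $(1,2,3)$-free if there are no points $x\prec y\prec z$ in $[n]^2$ with $f(x)<f(y)<f(z)$; for $\epsilon\in(0,1)$ it is $\epsilon$-far from $(1,2,3)$-free if every $(1,2,3)$-free function $g\colon[n]^2\to\mathbb{R}$ differs from $f$ in at least $\epsilon n^2$ points. A nonadaptive one-sided error $\epsilon$-tester for $(1,2,3)$-freeness making $q$ queries is a randomized algorithm that chooses $q$ query points in $[n]^2$ depending only on its random coins, sees the values of $f$ at these points, and then, depending on the coins and these values, accepts or rejects, in such a way that every $(1,2,3)$-free $f$ is accepted with probability $1$ and every $f$ that is $\epsilon$-far from $(1,2,3)$-free is rejected with probability at least $2/3$. **Theorem.** For constant $\epsilon\in(0,1)$ there is a nonadaptive one-sided error $\epsilon$-tester for $(1,2,3)$-freeness of functions $f\colon[n]^2\to\mathbb{R}$ that makes $\log^{O(1)} n$ queries. That is, there is an absolute constant $c$ such that for every $\epsilon\in(0,1)$ there is a constant $C=C(\epsilon)$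 such that for every $n\ge 1$ there is such a tester making at most $C\,(\log n)^{c}$ queries. -/

import Mathlib

/-- The hypergrid `[n]^d`. The coordinates are numbered from `0`. Its order is the coordinatewise
one: `x < y` holds iff `x i ≤ y i` for all `i` and `x ≠ y`. -/
abbrev HyperGrid (n d : ℕ) : Type := Fin d → Fin n

/-- The points `x 0 ≺ x 1 ≺ ⋯ ≺ x (k - 1)` of the hypergrid form a `π`-appearance in `f`. -/
def IsPatternAppearance {n d k : ℕ} (π : Equiv.Perm (Fin k)) (f : HyperGrid n d → ℝ)
    (x : Fin k → HyperGrid n d) : Prop :=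
  StrictMono x ∧ ∀ i j : Fin k, π i < π j → f (x i) < f (x j)

/-- `f` is `π`-free: it has no `π`-appearance. -/
def PatternFree {n d k : ℕ} (π : Equiv.Perm (Fin k)) (f : HyperGrid n d → ℝ) : Prop :=
  ¬ ∃ x : Fin k → HyperGrid n d, IsPatternAppearance π f x

/-- `f` is `ε`-far from `π`-freeness: at least `ε n^d` of its values have to be modified in order
to make it `π`-free. -/
def FarFromPatternFree {n d k : ℕ} (π : Equiv.Perm (Fin k)) (ε : ℝ)
    (f : HyperGrid n d → ℝ) : Prop :=
  ∀ g : HyperGrid n d → ℝ, PatternFree π g → ε * (n : ℝ) ^ d ≤ (hammingDist f g : ℝ)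

/-- A nonadaptive randomized algorithm with oracle access to a real-valued function on `D` that
makes `q` queries: it draws a random seed, chooses all `q` query points from the seed alone, and
then accepts (`true`) or rejects (`false`) on the basis of the seed and the `q` answers. -/
structure NonadaptiveAlgorithm (D : Type) (q : ℕ) where
  Seed : Type
  [fintypeSeed : Fintype Seed]
  /-- the distribution of the seed -/
  coins : PMF Seed
  /-- the query points -/
  query : Seed → Fin q → D
  /-- the decision, from the seed and the answers -/
  verdict : Seed → (Fin q → ℝ) → Bool

/-- The distribution of the output on the input `f`. -/
noncomputable def NonadaptiveAlgorithm.output {D : Type} {q : ℕ} (T : NonadaptiveAlgorithm D q)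
    (f : D → ℝ) : PMF Bool :=
  T.coins.map fun s => T.verdict s fun i => f (T.query s i)

/-- `T` is a one-sided error `ε`-tester for `π`-freeness of functions `f : [n]^d → ℝ`: it accepts
every `π`-free function with probability `1` and rejects every function that is `ε`-far from
`π`-freeness with probability at least `2/3`. -/
def NonadaptiveAlgorithm.IsOneSidedTester {n d q k : ℕ}
    (T : NonadaptiveAlgorithm (HyperGrid n d) q) (π : Equiv.Perm (Fin k)) (ε : ℝ) : Prop :=
  (∀ f : HyperGrid n d → ℝ, PatternFree π f → T.output f true = 1) ∧
  (∀ f : HyperGrid n d → ℝ, FarFromPatternFree π ε f → 2 / 3 ≤ T.output f false)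

/-- The pattern `(1,2,3)`. -/
def pattern123 : Equiv.Perm (Fin 3) := Equiv.refl (Fin 3)

/-!
The tester draws random triples `x ≺ y ≺ z`, choosing the middle point `y` first, and looks for an
appearance among them. What makes this succeed is that, for a suitable pair of scales, the choices
of `x` and `z` given `y` may be independent.

*Scales.* On `{0, …, n - 1}` consider equality and, for each `s ≤ log₂ n`, the relation "`b` lies in
the dyadic block of length `2 ^ s` directly after that of `a`". Their union is `≤`
(`exists_linkedAt`). Applying them coordinatewise gives `K = (⌊log₂ n⌋ + 2) ^ d` relations `R σ` on
the grid whose union is the order and each of which is difunctional: the predecessor sets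
`{u | R σ u y}` are pairwise equal or disjoint, and likewise the successor sets.

*Low points.* Call `x` low for `σ` if in its predecessor set fewer than a `δ`-fraction of the points
`u` have `f u ≤ f x`. As the predecessor sets are disjoint, at most `δ n ^ d` points are low for `σ`
(`IsDifunctional.card_lowPoints_le`). High points are treated symmetrically.

*Pivots.* Let `x ≺ y ≺ z` be an appearance, with `x` linked to `y` at scale `σ` and `y` linked to `z` at
scale `τ`. If `x` is not low and `z` is not high, then a `δ`-fraction of the predecessors `u` of
`y` has `f u ≤ f x < f y` and a `δ`-fraction of the successors `w` has `f y < f z ≤ f w`; so `y` is a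
pivot, and independent random `u` and `w` form an appearance with `y` with probability at least
`δ ^ 2`. The low points, the high points and the pivots therefore meet every appearance. A function
whose appearances all meet a set `B` can be repaired on `B` (`exists_patternFree_eqOn_compl`); hence
if `f` is `ε`-far and `δ = ε / (4 K)`, then at least half of `ε n ^ d` points are pivots
(`card_pivots_ge`). A random triple is thus an appearance with probability at least
`K⁻² (ε / 2) δ ^ 2`, which is polylogarithmic, and independent repetition gives the tester.
-/

/-! ### Repairing a function on a set that meets all appearances -/

/-- If all `(1,2,3)`-appearances of `f` meet `B`, then changing `f` on `B` alone removes them. Off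
`B`, let `U` be the set of upper ends of increasing pairs; `f` is antitone both on `U` and on the
rest. The function `f` on the rest extends to an antitone function `h` on all of `D`; taking `f` on
`U` and `h` elsewhere leaves no three increasing values, as two of the points would lie in the same
class. -/
theorem exists_patternFree_eqOn_compl {D : Type*} [Fintype D] [PartialOrder D] (f : D → ℝ)
    (B : Finset D)
    (hB : ∀ x y z, x ∉ B → y ∉ B → z ∉ B → x < y → y < z → f x < f y → f y < f z → False) :
    ∃ g : D → ℝ, (∀ x ∉ B, g x = f x) ∧
      ∀ x y z, x < y → y < z → g x < g y → g y < g z → False := by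
  classical
  -- `m` is the value of the extension at points with nothing of the lower class above them.
  obtain ⟨m, hm⟩ : BddBelow (Set.range f) := (Set.finite_range f).bddBelow
  replace hm : ∀ x, m ≤ f x := fun x => hm ⟨x, rfl⟩
  set U : Set D := {y | y ∉ B ∧ ∃ w, w ∉ B ∧ w < y ∧ f w < f y} with hU
  set A : Set D := {y | y ∉ B ∧ y ∉ U} with hA
  have hanti : ∀ x ∈ A, ∀ y ∈ A, x ≤ y → f y ≤ f x := by
    intro x hx y hy hxy
    by_contra! h
    refine hy.2 ⟨hy.1, x, hx.1, lt_of_le_of_ne hxy ?_, h⟩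
    rintro rfl
    exact lt_irrefl _ h
  set s : D → Set ℝ := fun x => insert m (f '' {y | y ∈ A ∧ x ≤ y}) with hs
  have hbdd : ∀ x, BddAbove (s x) := fun x => ((Set.toFinite _).insert m).bddAbove
  set h : D → ℝ := fun x => sSup (s x) with hh
  have h_anti : ∀ x y, x ≤ y → h y ≤ h x := fun x y hxy =>
    csSup_le_csSup (hbdd x) ⟨m, Set.mem_insert _ _⟩
      (Set.insert_subset_insert (Set.image_mono fun w hw => ⟨hw.1, hxy.trans hw.2⟩))
  have h_eq : ∀ x ∈ A, h x = f x := by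
    intro x hx
    refine IsGreatest.csSup_eq ⟨Or.inr ⟨x, ⟨hx, le_rfl⟩, rfl⟩, ?_⟩
    rintro _ (rfl | ⟨y, ⟨hy, hxy⟩, rfl⟩)
    exacts [hm x, hanti x hx y hy hxy]
  refine ⟨fun x => if x ∈ U then f x else h x, fun x hx => ?_, ?_⟩
  · by_cases hxU : x ∈ U
    · simp [hxU]
    · simp [hxU, h_eq x ⟨hx, hxU⟩]
  have key : ∀ x y, x < y → (if x ∈ U then f x else h x) < (if y ∈ U then f y else h y) →
      (x ∈ U ↔ y ∉ U) := by
    intro x y hxy hlt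
    by_cases hx : x ∈ U <;> by_cases hy : y ∈ U <;> simp only [hx, hy, if_true, if_false] at hlt ⊢
    · obtain ⟨hxB, w, hwB, hwx, hw⟩ := hx
      exact (hB w x y hwB hxB hy.1 hwx hxy hw hlt).elim
    · simp
    · simp
    · exact absurd (h_anti x y hxy.le) (not_le.mpr hlt)
  intro x y z hxy hyz h1 h2
  have a := key x y hxy h1
  have b := key y z hyz h2
  have c := key x z (hxy.trans hyz) (h1.trans h2)
  tauto

/-! ### Difunctional relations and low points -/

/-- A relation is difunctional if the sets of predecessors of any two points are equal or disjoint
(equivalently, the sets of successors are). -/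
def IsDifunctional {α : Type*} {β : Type*} (R : α → β → Prop) : Prop :=
  ∀ ⦃x y u v⦄, R x y → R x v → R u y → R u v

theorem IsDifunctional.flip {α : Type*} {β : Type*} {R : α → β → Prop} (hR : IsDifunctional R) :
    IsDifunctional (flip R) :=
  fun _ _ _ _ hxy hxv huy => hR hxy huy hxv

open Classical in
/-- The points whose `f`-value is among the lowest `δ`-fraction of a predecessor set `{u | R u y}`
containing them. -/
noncomputable def lowPoints {D E : Type*} [Fintype D] (R : D → E → Prop) (f : D → ℝ) (δ : ℝ) :
    Finset D :=
  {x | ∃ y, R x y ∧ (Finset.card {u | R u y ∧ f u ≤ f x} : ℝ) < δ * Finset.card {u | R u y}}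

open Classical in
theorem mem_lowPoints {D E : Type*} [Fintype D] {R : D → E → Prop} {f : D → ℝ} {δ : ℝ} {x : D} :
    x ∈ lowPoints R f δ ↔ ∃ y, R x y ∧
      (Finset.card {u | R u y ∧ f u ≤ f x} : ℝ) < δ * Finset.card {u | R u y} := by
  simp [lowPoints]

open Classical in
/-- Each predecessor set contains at most a `δ`-fraction of low points, namely at most as many as
there are points below its highest low point, and the predecessor sets are disjoint. -/
theorem IsDifunctional.card_lowPoints_le {D E : Type*} [Fintype D] [Fintype E] {R : D → E → Prop}
    (hR : IsDifunctional R) (f : D → ℝ) {δ : ℝ} (hδ : 0 ≤ δ) :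
    ((lowPoints R f δ).card : ℝ) ≤ δ * Fintype.card D := by
  set pred : E → Finset D := fun y => {u | R u y} with hpred
  set low : Finset D → Finset D :=
    fun P => {x ∈ P | (Finset.card {u ∈ P | f u ≤ f x} : ℝ) < δ * P.card} with hlow
  have hlow_card : ∀ P : Finset D, ((low P).card : ℝ) ≤ δ * P.card := by
    intro P
    rcases (low P).eq_empty_or_nonempty with h | h
    · rw [h]; simp; positivity
    · obtain ⟨x, hx, hmax⟩ := Finset.exists_max_image (low P) f h
      refine le_trans ?_ (Finset.mem_filter.mp hx).2.le
      exact_mod_cast Finset.card_le_card fun u hu =>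
        Finset.mem_filter.mpr ⟨(Finset.mem_filter.mp hu).1, hmax u hu⟩
  set C : Finset (Finset D) := Finset.univ.image pred
  have hdisj : (C : Set (Finset D)).PairwiseDisjoint id := by
    intro P hP Q hQ hPQ
    simp only [C, Finset.coe_image, Finset.coe_univ, Set.image_univ, Set.mem_range] at hP hQ
    obtain ⟨y, rfl⟩ := hP
    obtain ⟨v, rfl⟩ := hQ
    refine Finset.disjoint_left.mpr fun x hx hx' => hPQ ?_
    simp only [hpred, id, Finset.mem_filter, Finset.mem_univ, true_and] at hx hx' ⊢
    ext u
    simp only [Finset.mem_filter, Finset.mem_univ, true_and]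
    exact ⟨hR hx hx', hR hx' hx⟩
  calc ((lowPoints R f δ).card : ℝ)
      ≤ ((C.biUnion low).card : ℝ) := by
        refine Nat.cast_le.mpr (Finset.card_le_card fun x hx => ?_)
        obtain ⟨y, hxy, hy⟩ := mem_lowPoints.mp hx
        refine Finset.mem_biUnion.mpr ⟨pred y, Finset.mem_image_of_mem _ (Finset.mem_univ _), ?_⟩
        simpa [hlow, hpred, hxy, Finset.filter_filter] using hy
    _ ≤ ∑ P ∈ C, ((low P).card : ℝ) := by exact_mod_cast Finset.card_biUnion_le
    _ ≤ ∑ P ∈ C, δ * (P.card : ℝ) := Finset.sum_le_sum fun P _ => hlow_card P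
    _ = δ * ((C.biUnion id).card : ℝ) := by
        rw [Finset.card_biUnion hdisj, Nat.cast_sum, Finset.mul_sum]; rfl
    _ ≤ δ * Fintype.card D := by
        gcongr
        exact Finset.card_le_univ _

/-! ### Pivots -/

open Classical in
/-- The points `y` that are the middle of many appearances: for suitable scales `σ` and `τ`, a
`δ`-fraction of the `R σ`-predecessors of `y` has values below `f y`, and a `δ`-fraction of the
`R τ`-successors of `y` has values above `f y`. -/
noncomputable def pivots {D S : Type*} [Fintype D] (R : S → D → D → Prop) (f : D → ℝ) (δ : ℝ) :
    Finset D :=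
  {y | ∃ σ τ, (∃ x, R σ x y) ∧ (∃ z, R τ y z) ∧
    δ * Finset.card {u | R σ u y} ≤ Finset.card {u | R σ u y ∧ f u < f y} ∧
    δ * Finset.card {w | R τ y w} ≤ Finset.card {w | R τ y w ∧ f y < f w}}

open Classical in
theorem mem_pivots {D S : Type*} [Fintype D] {R : S → D → D → Prop} {f : D → ℝ} {δ : ℝ} {y : D} :
    y ∈ pivots R f δ ↔ ∃ σ τ, (∃ x, R σ x y) ∧ (∃ z, R τ y z) ∧
      δ * Finset.card {u | R σ u y} ≤ Finset.card {u | R σ u y ∧ f u < f y} ∧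
      δ * Finset.card {w | R τ y w} ≤ Finset.card {w | R τ y w ∧ f y < f w} := by
  simp [pivots]

/-- If `x < y < z` is an appearance with `x` linked to `y` and `y` linked to `z`, then `x` is low,
or `z` is high, or `y` is a pivot. So the pivots together with the few low and high points of all
scales meet every appearance, and `f` can be repaired on their union. -/
theorem card_pivots_ge {D S : Type*} [Fintype D] [PartialOrder D] [Fintype S]
    {R : S → D → D → Prop} (hR : ∀ σ, IsDifunctional (R σ)) (hcover : ∀ x y, x ≤ y → ∃ σ, R σ x y)
    {f : D → ℝ} {N δ : ℝ} (hδ : 0 ≤ δ)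
    (hfar : ∀ g : D → ℝ, (∀ x y z, x < y → y < z → g x < g y → g y < g z → False) →
      N ≤ hammingDist f g) :
    N - 2 * Fintype.card S * δ * Fintype.card D ≤ ((pivots R f δ).card : ℝ) := by
  classical
  set low : Finset D := Finset.univ.biUnion fun σ => lowPoints (R σ) f δ with hlow
  -- The high points are the low points of `-f` for the converse relations.
  set high : Finset D := Finset.univ.biUnion fun σ => lowPoints (flip (R σ)) (-f) δ with hhigh
  have hcard : ∀ Q : S → D → D → Prop, (∀ σ, IsDifunctional (Q σ)) → ∀ h : D → ℝ,
      (((Finset.univ.biUnion fun σ => lowPoints (Q σ) h δ).card : ℕ) : ℝ) ≤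
        Fintype.card S * (δ * Fintype.card D) := by
    intro Q hQ h
    calc (((Finset.univ.biUnion fun σ => lowPoints (Q σ) h δ).card : ℕ) : ℝ)
        ≤ ∑ σ, ((lowPoints (Q σ) h δ).card : ℝ) := by exact_mod_cast Finset.card_biUnion_le
      _ ≤ ∑ _σ : S, δ * Fintype.card D :=
          Finset.sum_le_sum fun σ _ => (hQ σ).card_lowPoints_le h hδ
      _ = _ := by simp
  have h_low := hcard R hR f
  have h_high := hcard (fun σ => flip (R σ)) (fun σ => (hR σ).flip) (-f)
  obtain ⟨g, hg, hfree⟩ := exists_patternFree_eqOn_compl f (pivots R f δ ∪ low ∪ high) (by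
    intro x y z hx hy hz hxy hyz h1 h2
    simp only [Finset.mem_union, not_or] at hx hy hz
    obtain ⟨σ, hσ⟩ := hcover x y hxy.le
    obtain ⟨τ, hτ⟩ := hcover y z hyz.le
    have hx' := hx.1.2
    have hz' := hz.2
    simp only [hlow, hhigh, Finset.mem_biUnion, mem_lowPoints, Finset.mem_univ,
      true_and, not_exists, not_and, not_lt, flip, Pi.neg_apply, neg_le_neg_iff] at hx' hz'
    refine hy.1.1 (mem_pivots.mpr
      ⟨σ, τ, ⟨x, hσ⟩, ⟨z, hτ⟩, (hx' σ y hσ).trans ?_, (hz' τ y hτ).trans ?_⟩)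
    · refine Nat.cast_le.mpr (Finset.card_le_card fun u hu => ?_)
      rw [Finset.mem_filter] at hu ⊢
      exact ⟨hu.1, hu.2.1, hu.2.2.trans_lt h1⟩
    · refine Nat.cast_le.mpr (Finset.card_le_card fun u hu => ?_)
      rw [Finset.mem_filter] at hu ⊢
      exact ⟨hu.1, hu.2.1, h2.trans_le hu.2.2⟩)
  have hdist : (hammingDist f g : ℝ) ≤
      ((pivots R f δ).card : ℝ) + (low.card : ℝ) + (high.card : ℝ) := by
    have h1 : hammingDist f g ≤ (pivots R f δ ∪ low ∪ high).card := by
      refine Finset.card_le_card fun x hx => ?_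
      by_contra hxB
      exact (Finset.mem_filter.mp hx).2 (hg x hxB).symm
    have h2 := (Finset.card_union_le (pivots R f δ ∪ low) high).trans
      (Nat.add_le_add_right (Finset.card_union_le _ _) _)
    exact_mod_cast h1.trans h2
  have := hfar g hfree
  linarith

/-! ### Finite distributions -/

open Classical in
/-- The uniform distribution on `A`; the point mass at `d` if `A` is empty. -/
noncomputable def PMF.uniformOr {α : Type*} (A : Finset α) (d : α) : PMF α :=
  if h : A.Nonempty then PMF.uniformOfFinset A h else PMF.pure d

theorem PMF.le_toOuterMeasure_uniformOr {α : Type*} {A B : Finset α} (hA : A.Nonempty) (hBA : B ⊆ A)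
    {d : α} {δ : ℝ} (h : δ * A.card ≤ B.card) :
    ENNReal.ofReal δ ≤ (PMF.uniformOr A d).toOuterMeasure B := by
  classical
  rw [PMF.uniformOr, dif_pos hA, PMF.toOuterMeasure_uniformOfFinset_apply]
  have hfilter : A.filter (· ∈ (B : Set α)) = B := by
    ext x; simpa using fun hx => hBA hx
  simp only [Finset.mem_coe] at hfilter ⊢
  rw [hfilter]
  have hA' : (0 : ℝ) < A.card := by exact_mod_cast hA.card_pos
  rw [← ENNReal.ofReal_natCast, ← ENNReal.ofReal_natCast, ← ENNReal.ofReal_div_of_pos hA']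
  exact ENNReal.ofReal_le_ofReal ((le_div_iff₀ hA').mpr h)

theorem PMF.mul_le_toOuterMeasure_bind {α β : Type*} (p : PMF α) (k : α → PMF β) (A : Set α)
    (B : Set β) {a b : ENNReal} (ha : a ≤ p.toOuterMeasure A)
    (hb : ∀ x ∈ A, b ≤ (k x).toOuterMeasure B) : a * b ≤ (p.bind k).toOuterMeasure B := by
  classical
  rw [PMF.toOuterMeasure_bind_apply]
  calc a * b ≤ p.toOuterMeasure A * b := by gcongr
    _ = ∑' x, A.indicator p x * b := by rw [PMF.toOuterMeasure_apply, ENNReal.tsum_mul_right]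
    _ ≤ _ := by
      refine ENNReal.tsum_le_tsum fun x => ?_
      by_cases hx : x ∈ A
      · rw [Set.indicator_of_mem hx]; gcongr; exact hb x hx
      · simp [hx]

/-- The distribution of `m` independent samples from `p`. -/
noncomputable def PMF.iid {α : Type*} [Fintype α] (p : PMF α) (m : ℕ) : PMF (Fin m → α) :=
  PMF.ofFintype (fun s => ∏ i, p (s i)) (by
    rw [← Fintype.sum_pow, ← tsum_fintype (L := .unconditional _), p.tsum_coe, one_pow])

theorem PMF.toOuterMeasure_iid_pi {α : Type*} [Fintype α] (p : PMF α) (m : ℕ) (A : Set α) :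
    (p.iid m).toOuterMeasure {s | ∀ i, s i ∈ A} = p.toOuterMeasure A ^ m := by
  classical
  rw [PMF.toOuterMeasure_apply_fintype, PMF.toOuterMeasure_apply_fintype, Fintype.sum_pow]
  refine Finset.sum_congr rfl fun s _ => ?_
  by_cases hs : ∀ i, s i ∈ A
  · rw [Set.indicator_of_mem (show s ∈ {s : Fin m → α | ∀ i, s i ∈ A} from hs)]
    exact (PMF.ofFintype_apply _ s).trans <| Finset.prod_congr rfl fun i _ =>
      (Set.indicator_of_mem (hs i) p).symm
  · rw [Set.indicator_of_notMem (show s ∉ {s : Fin m → α | ∀ i, s i ∈ A} from hs)]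
    push Not at hs
    obtain ⟨i, hi⟩ := hs
    exact (Finset.prod_eq_zero (f := fun i => A.indicator p (s i))
      (Finset.mem_univ i) (Set.indicator_of_notMem hi p)).symm

theorem PMF.toOuterMeasure_add_compl {α : Type*} (p : PMF α) (A : Set α) :
    p.toOuterMeasure A + p.toOuterMeasure Aᶜ = 1 := by
  rw [PMF.toOuterMeasure_apply, PMF.toOuterMeasure_apply, ← ENNReal.tsum_add, ← p.tsum_coe]
  exact tsum_congr fun x => congrFun (Set.indicator_self_add_compl A p) x

/-! ### The random triple -/

open Classical in
/-- A random triple `(x, y, z)`: two scales `σ`, `τ` and the point `y` are chosen uniformly,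
and then `x` among the `R σ`-predecessors and `z` among the `R τ`-successors of `y`. If there are no
predecessors or no successors, then `y` is repeated. -/
noncomputable def pivotSampler {D S : Type*} [Fintype D] [Nonempty D] [Fintype S] [Nonempty S]
    (R : S → D → D → Prop) : PMF (D × D × D) :=
  (PMF.uniformOfFintype (S × S × D)).bind fun t =>
    (PMF.uniformOr {u | R t.1 u t.2.2} t.2.2).bind fun x =>
      (PMF.uniformOr {w | R t.2.1 t.2.2 w} t.2.2).map fun z => (x, t.2.2, z)

theorem le_toOuterMeasure_pivotSampler {D S : Type*} [Fintype D] [Nonempty D] [PartialOrder D]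
    [Fintype S] [Nonempty S] {R : S → D → D → Prop} (hle : ∀ σ x y, R σ x y → x ≤ y)
    (f : D → ℝ) {δ : ℝ} (hδ : 0 ≤ δ) :
    ENNReal.ofReal ((pivots R f δ).card / (Fintype.card S ^ 2 * Fintype.card D) * δ ^ 2) ≤
      (pivotSampler R).toOuterMeasure
        {t | t.1 < t.2.1 ∧ t.2.1 < t.2.2 ∧ f t.1 < f t.2.1 ∧ f t.2.1 < f t.2.2} := by
  classical
  have hlt : ∀ {σ x y}, R σ x y → f x ≠ f y → x < y := fun h hne =>
    lt_of_le_of_ne (hle _ _ _ h) fun h => hne (congrArg f h)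
  rw [ENNReal.ofReal_mul (by positivity), pow_two δ, ENNReal.ofReal_mul hδ]
  let A : Finset (S × S × D) := {t | (∃ x, R t.1 x t.2.2) ∧ (∃ z, R t.2.1 t.2.2 z) ∧
      δ * Finset.card {u | R t.1 u t.2.2} ≤ Finset.card {u | R t.1 u t.2.2 ∧ f u < f t.2.2} ∧
      δ * Finset.card {w | R t.2.1 t.2.2 w} ≤
        Finset.card {w | R t.2.1 t.2.2 w ∧ f t.2.2 < f w}}
  refine PMF.mul_le_toOuterMeasure_bind _ _ (A : Set (S × S × D)) _ ?_ ?_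
  · have hA : (pivots R f δ).card ≤ A.card := by
      refine (Finset.card_le_card fun y hy => ?_).trans
        (Finset.card_image_le (s := A) (f := fun t => t.2.2))
      obtain ⟨σ, τ, h⟩ := mem_pivots.mp hy
      exact Finset.mem_image.mpr ⟨(σ, τ, y), Finset.mem_filter.mpr ⟨Finset.mem_univ _, h⟩, rfl⟩
    have hpos : (0 : ℝ) < Fintype.card (S × S × D) := by exact_mod_cast Fintype.card_pos
    rw [PMF.toOuterMeasure_uniformOfFintype_apply, ← ENNReal.ofReal_natCast,
      ← ENNReal.ofReal_natCast, ← ENNReal.ofReal_div_of_pos hpos]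
    refine ENNReal.ofReal_le_ofReal ?_
    have : (Fintype.card (S × S × D) : ℝ) = Fintype.card S ^ 2 * Fintype.card D := by
      simp only [Fintype.card_prod]; push_cast; ring
    rw [this]
    have hA' : Fintype.card (A : Set (S × S × D)) = A.card := by simp
    gcongr
    rw [hA']
    exact hA
  · rintro ⟨σ, τ, y⟩ ht
    obtain ⟨⟨x₀, hx₀⟩, ⟨z₀, hz₀⟩, hx, hz⟩ := (Finset.mem_filter.mp ht).2
    refine PMF.mul_le_toOuterMeasure_bind _ _
      (Finset.filter (fun u => R σ u y ∧ f u < f y) Finset.univ : Set D) _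
      (PMF.le_toOuterMeasure_uniformOr ⟨x₀, by simpa using hx₀⟩
        (Finset.monotone_filter_right _ fun _ _ h => h.1) hx) fun x hx' => ?_
    rw [PMF.toOuterMeasure_map_apply]
    refine (PMF.le_toOuterMeasure_uniformOr ⟨z₀, by simpa using hz₀⟩
        (Finset.monotone_filter_right _ fun _ _ h => h.1) hz).trans
      (MeasureTheory.measure_mono fun z hz' => ?_)
    have h1 := (Finset.mem_filter.mp hx').2
    have h2 := (Finset.mem_filter.mp hz').2
    exact ⟨hlt h1.1 h1.2.ne, hlt h2.1 h2.2.ne, h1.2, h2.2⟩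

/-! ### The tester -/

theorem isPatternAppearance_pattern123_iff {n d : ℕ} {f : HyperGrid n d → ℝ}
    {x : Fin 3 → HyperGrid n d} :
    IsPatternAppearance pattern123 f x ↔
      x 0 < x 1 ∧ x 1 < x 2 ∧ f (x 0) < f (x 1) ∧ f (x 1) < f (x 2) := by
  constructor
  · rintro ⟨hx, hf⟩
    exact ⟨hx (by decide), hx (by decide), hf 0 1 (by decide), hf 1 2 (by decide)⟩
  · rintro ⟨h01, h12, hf01, hf12⟩
    refine ⟨Fin.strictMono_iff_lt_succ.mpr fun i => ?_, fun i j hij => ?_⟩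
    · fin_cases i
      exacts [h01, h12]
    · exact (Fin.strictMono_iff_lt_succ (f := f ∘ x).mpr fun i => by
        fin_cases i
        exacts [hf01, hf12]) hij

open Classical in
/-- The algorithm that draws `m` independent triples from `p`, queries all their points and rejects
iff one of the triples is a chain with increasing values. -/
noncomputable def repeatedTripleTest {D : Type} [Fintype D] [LT D] (p : PMF (D × D × D)) (m : ℕ) :
    NonadaptiveAlgorithm D (m * 3) where
  Seed := Fin m → D × D × D
  coins := p.iid m
  query s i := ![(s (finProdFinEquiv.symm i).1).1, (s (finProdFinEquiv.symm i).1).2.1,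
    (s (finProdFinEquiv.symm i).1).2.2] (finProdFinEquiv.symm i).2
  verdict s a := decide (∀ i, ¬ ((s i).1 < (s i).2.1 ∧ (s i).2.1 < (s i).2.2 ∧
    a (finProdFinEquiv (i, 0)) < a (finProdFinEquiv (i, 1)) ∧
    a (finProdFinEquiv (i, 1)) < a (finProdFinEquiv (i, 2))))

theorem output_repeatedTripleTest_true {D : Type} [Fintype D] [LT D] (p : PMF (D × D × D)) (m : ℕ)
    (f : D → ℝ) :
    (repeatedTripleTest p m).output f true = p.toOuterMeasure
      {t | t.1 < t.2.1 ∧ t.2.1 < t.2.2 ∧ f t.1 < f t.2.1 ∧ f t.2.1 < f t.2.2}ᶜ ^ m := by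
  rw [← PMF.toOuterMeasure_iid_pi, ← PMF.toOuterMeasure_apply_singleton,
    NonadaptiveAlgorithm.output, PMF.toOuterMeasure_map_apply]
  simp only [repeatedTripleTest]
  congr 1
  ext s
  simp

/-- With `m ≥ 2 / η` independent triples, each successful with probability at least `η`, the failure
probability is at most `(1 - η) ^ m ≤ exp (-2) ≤ 1 / 3`. -/
theorem repeatedTripleTest_isOneSidedTester {n d : ℕ}
    {p : PMF (HyperGrid n d × HyperGrid n d × HyperGrid n d)} {m : ℕ} {ε η : ℝ}
    (hη : 0 < η) (hm : 2 / η ≤ m)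
    (hp : ∀ f : HyperGrid n d → ℝ, FarFromPatternFree pattern123 ε f →
      ENNReal.ofReal η ≤ p.toOuterMeasure
        {t | t.1 < t.2.1 ∧ t.2.1 < t.2.2 ∧ f t.1 < f t.2.1 ∧ f t.2.1 < f t.2.2}) :
    (repeatedTripleTest p m).IsOneSidedTester pattern123 ε := by
  refine ⟨fun f hf => ?_, fun f hf => ?_⟩
  · have hempty : {t : HyperGrid n d × HyperGrid n d × HyperGrid n d |
        t.1 < t.2.1 ∧ t.2.1 < t.2.2 ∧ f t.1 < f t.2.1 ∧ f t.2.1 < f t.2.2} = ∅ := by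
      refine Set.eq_empty_of_forall_notMem fun t ht => hf ⟨![t.1, t.2.1, t.2.2], ?_⟩
      exact isPatternAppearance_pattern123_iff.mpr ht
    have h := p.toOuterMeasure_add_compl ∅
    rw [MeasureTheory.measure_empty, zero_add] at h
    rw [output_repeatedTripleTest_true, hempty, h, one_pow]
  · set E : Set (HyperGrid n d × HyperGrid n d × HyperGrid n d) :=
      {t | t.1 < t.2.1 ∧ t.2.1 < t.2.2 ∧ f t.1 < f t.2.1 ∧ f t.2.1 < f t.2.2} with hE
    have hcompl : p.toOuterMeasure Eᶜ ≤ ENNReal.ofReal (Real.exp (-η)) := by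
      have h := p.toOuterMeasure_add_compl E
      have h1 : p.toOuterMeasure Eᶜ ≤ 1 - ENNReal.ofReal η := by
        refine ENNReal.le_sub_of_add_le_right ENNReal.ofReal_ne_top ?_
        rw [← h, add_comm]
        gcongr
        exact hp f hf
      refine h1.trans ?_
      rw [← ENNReal.ofReal_one, ← ENNReal.ofReal_sub _ hη.le]
      exact ENNReal.ofReal_le_ofReal (by linarith [Real.add_one_le_exp (-η)])
    have htrue : (repeatedTripleTest p m).output f true ≤ ENNReal.ofReal (1 / 3) := by
      rw [output_repeatedTripleTest_true]
      refine (pow_le_pow_left' hcompl m).trans ?_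
      rw [← ENNReal.ofReal_pow (Real.exp_nonneg _), ← Real.exp_nat_mul]
      refine ENNReal.ofReal_le_ofReal ?_
      have h2 : 2 ≤ m * η := (div_le_iff₀ hη).mp hm
      calc Real.exp (m * -η) ≤ Real.exp (-2) := Real.exp_le_exp.mpr (by linarith)
        _ = (Real.exp 2)⁻¹ := Real.exp_neg 2
        _ ≤ 3⁻¹ := by gcongr; linarith [Real.add_one_le_exp 2]
        _ = 1 / 3 := by norm_num
    have hsum : (repeatedTripleTest p m).output f true + (repeatedTripleTest p m).output f false
        = 1 := by
      have := ((repeatedTripleTest p m).output f).tsum_coe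
      rwa [tsum_fintype, Fintype.sum_bool] at this
    have h23 : (2 / 3 : ENNReal) = 1 - ENNReal.ofReal (1 / 3) := by
      rw [← ENNReal.ofReal_one, ← ENNReal.ofReal_sub _ (by norm_num),
        show (1 - 1 / 3 : ℝ) = 2 / 3 by norm_num, ENNReal.ofReal_div_of_pos (by norm_num)]
      simp
    rw [h23]
    refine tsub_le_iff_left.mpr ?_
    rw [← hsum]
    gcongr

/-! ### Dyadic scales -/

/-- `LinkedAt none` is equality. `LinkedAt (some s) a b` says that `b` lies in the dyadic block of
length `2 ^ s` that directly follows the block of `a`. -/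
def LinkedAt : Option ℕ → ℕ → ℕ → Prop
  | none, a, b => a = b
  | some s, a, b => a / 2 ^ s + 1 = b / 2 ^ s

theorem LinkedAt.le {ℓ : Option ℕ} {a b : ℕ} (h : LinkedAt ℓ a b) : a ≤ b := by
  rcases ℓ with _ | s
  · exact le_of_eq h
  · by_contra! hlt
    have := Nat.div_le_div_right (c := 2 ^ s) hlt.le
    simp only [LinkedAt] at h
    omega

theorem isDifunctional_linkedAt (ℓ : Option ℕ) : IsDifunctional (LinkedAt ℓ) := by
  intro a b u v
  rcases ℓ with _ | s <;> simp only [LinkedAt] <;> omega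

/-- Let `s + 1` be the least level at which `a < b` share a dyadic block: at level `s` their blocks
are the two consecutive halves of that block. -/
theorem exists_linkedAt {n a b : ℕ} (hab : a ≤ b) (hb : b < n) :
    ∃ ℓ : Option (Fin (Nat.log 2 n + 1)), LinkedAt (ℓ.map Fin.val) a b := by
  rcases hab.eq_or_lt with rfl | hlt
  · exact ⟨none, rfl⟩
  have hex : ∃ s, a / 2 ^ s = b / 2 ^ s := by
    refine ⟨n, ?_⟩
    have := Nat.lt_two_pow_self (n := n)
    rw [Nat.div_eq_of_lt (by omega), Nat.div_eq_of_lt (by omega)]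
  classical
  obtain ⟨s, hs⟩ : ∃ s, Nat.find hex = s + 1 := by
    refine Nat.exists_eq_succ_of_ne_zero fun h => ?_
    have := Nat.find_spec hex
    rw [h] at this
    simp at this
    omega
  have h1 : a / 2 ^ s ≠ b / 2 ^ s := Nat.find_min hex (by omega)
  have h2 : a / 2 ^ s / 2 = b / 2 ^ s / 2 := by
    have := Nat.find_spec hex
    rw [hs, pow_succ] at this
    rwa [Nat.div_div_eq_div_mul, Nat.div_div_eq_div_mul]
  have h3 : a / 2 ^ s ≤ b / 2 ^ s := Nat.div_le_div_right hab
  have h4 : 2 ^ s ≤ n := by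
    by_contra! h
    rw [Nat.div_eq_of_lt (by omega), Nat.div_eq_of_lt (by omega)] at h1
    exact h1 rfl
  have h5 : s ≤ Nat.log 2 n := Nat.le_log_of_pow_le (by norm_num) h4
  refine ⟨some ⟨s, by omega⟩, ?_⟩
  simp only [Option.map_some, LinkedAt]
  omega

/-- A choice, for each coordinate, of one of the `Nat.log 2 n + 2` one-dimensional relations
`LinkedAt` that matter on `{0, …, n - 1}`. -/
abbrev GridScale (n d : ℕ) : Type := Fin d → Option (Fin (Nat.log 2 n + 1))

/-- `x` and `y` are linked at scale `σ` if they are linked in every coordinate. The predecessors and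
the successors of a point at a given scale fill an axis-parallel box each. -/
def GridLinked {n d : ℕ} (σ : GridScale n d) (x y : HyperGrid n d) : Prop :=
  ∀ i, LinkedAt ((σ i).map Fin.val) (x i) (y i)

theorem GridLinked.le {n d : ℕ} {σ : GridScale n d} {x y : HyperGrid n d}
    (h : GridLinked σ x y) : x ≤ y :=
  fun i => (h i).le

theorem isDifunctional_gridLinked {n d : ℕ} (σ : GridScale n d) :
    IsDifunctional (GridLinked (n := n) σ) :=
  fun _ _ _ _ hxy hxv huy i => isDifunctional_linkedAt _ (hxy i) (hxv i) (huy i)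

theorem exists_gridLinked {n d : ℕ} {x y : HyperGrid n d} (hxy : x ≤ y) :
    ∃ σ : GridScale n d, GridLinked σ x y := by
  choose σ h using fun i => exists_linkedAt (Fin.le_def.mp (hxy i)) (y i).isLt
  exact ⟨σ, h⟩

/-- Here `δ = ε / (4 K)` for `K = (Nat.log 2 n + 2) ^ d` scales, so that the low and high points of
all scales make up at most half of the `ε n ^ d` points needed for a repair. -/
theorem FarFromPatternFree.le_toOuterMeasure_pivotSampler {n d : ℕ} [Nonempty (HyperGrid n d)]
    {f : HyperGrid n d → ℝ} {ε : ℝ} (hε : 0 < ε) (hf : FarFromPatternFree pattern123 ε f) :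
    ENNReal.ofReal (ε ^ 3 / (32 * ((Nat.log 2 n + 2) ^ d) ^ 4)) ≤
      (_root_.pivotSampler (GridLinked (n := n) (d := d))).toOuterMeasure
        {t | t.1 < t.2.1 ∧ t.2.1 < t.2.2 ∧ f t.1 < f t.2.1 ∧ f t.2.1 < f t.2.2} := by
  set K : ℝ := ((Nat.log 2 n : ℝ) + 2) ^ d with hK
  have hS : (Fintype.card (GridScale n d) : ℝ) = K := by
    simp only [Fintype.card_fun, Fintype.card_option, Fintype.card_fin, hK]
    push_cast
    ring
  have hD : (Fintype.card (HyperGrid n d) : ℝ) = (n : ℝ) ^ d := by simp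
  have hDpos : (0 : ℝ) < (n : ℝ) ^ d := by rw [← hD]; exact_mod_cast Fintype.card_pos
  have hKpos : 0 < K := by positivity
  have hδ : 0 ≤ ε / (4 * K) := by positivity
  refine le_trans (ENNReal.ofReal_le_ofReal ?_)
    (_root_.le_toOuterMeasure_pivotSampler (R := GridLinked (n := n) (d := d))
      (fun _ _ _ h => h.le) f hδ)
  have hpiv := card_pivots_ge (f := f) (N := ε * (n : ℝ) ^ d)
    (isDifunctional_gridLinked (n := n) (d := d)) (fun _ _ => exists_gridLinked) hδ (by
      intro g hg
      refine hf g fun ⟨x, hx⟩ => ?_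
      obtain ⟨h1, h2, h3, h4⟩ := isPatternAppearance_pattern123_iff.mp hx
      exact hg _ _ _ h1 h2 h3 h4)
  rw [hS, hD] at hpiv ⊢
  have hpiv' : ε / 2 * (n : ℝ) ^ d ≤
      ((pivots (GridLinked (n := n) (d := d)) f (ε / (4 * K))).card : ℝ) := by
    refine le_trans (le_of_eq ?_) hpiv
    field_simp
    ring
  calc ε ^ 3 / (32 * K ^ 4) = ε / 2 * (n : ℝ) ^ d / (K ^ 2 * (n : ℝ) ^ d) * (ε / (4 * K)) ^ 2 := by
        field_simp
        ring
    _ ≤ _ := by gcongr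

/-! ### The query bound -/

theorem natLog_two_add_two_le {n : ℕ} (hn : 2 ≤ n) : (Nat.log 2 n : ℝ) + 2 ≤ 5 * Real.log n := by
  have hn' : (2 : ℝ) ≤ n := by exact_mod_cast hn
  have h2 : 0.69 < Real.log 2 := by linarith [Real.log_two_gt_d9]
  have h1 : (Nat.log 2 n : ℝ) * Real.log 2 ≤ Real.log n := by
    rw [← Real.log_pow]
    exact Real.log_le_log (by positivity)
      (by exact_mod_cast Nat.pow_log_le_self 2 (by omega : n ≠ 0))
  have h3 : Real.log 2 ≤ Real.log n := Real.log_le_log (by norm_num) hn'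
  have h4 : (0 : ℝ) ≤ Nat.log 2 n := by positivity
  nlinarith

theorem mainTheorem4 :
    ∃ c : ℕ, ∀ ε : ℝ, 0 < ε → ε < 1 → ∃ C : ℝ, ∀ n : ℕ, 1 ≤ n →
      ∃ (q : ℕ) (T : NonadaptiveAlgorithm (HyperGrid n 2) q),
        T.IsOneSidedTester pattern123 ε ∧ (q : ℝ) ≤ C * Real.log n ^ c := by
  refine ⟨8, fun ε hε hε1 => ⟨288 * 5 ^ 8 / ε ^ 3, fun n hn => ?_⟩⟩
  have : NeZero n := ⟨by omega⟩
  set p := pivotSampler (GridLinked (n := n) (d := 2))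
  set K : ℝ := (Nat.log 2 n : ℝ) + 2 with hK
  have hK2 : 2 ≤ K := by simp [hK]
  -- For `n = 1` the query bound is `0`, and no function is far from `(1,2,3)`-freeness.
  rcases hn.eq_or_lt with rfl | hn2
  · refine ⟨_, repeatedTripleTest p 0, ⟨fun f _ => ?_, fun f hf => ?_⟩, by simp⟩
    · rw [output_repeatedTripleTest_true, pow_zero]
    · have hfree : PatternFree pattern123 f := fun ⟨x, hx⟩ =>
        hx.1.injective.ne (by decide : (0 : Fin 3) ≠ 1) (Subsingleton.elim _ _)
      have h := hf f hfree
      simp at h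
      linarith
  · set η : ℝ := ε ^ 3 / (32 * (K ^ 2) ^ 4) with hη
    have hηpos : 0 < η := by positivity
    have hη1 : η ≤ 1 := by
      rw [hη, div_le_one (by positivity)]
      have h1 : ε ^ 3 ≤ 1 := pow_le_one₀ hε.le hε1.le
      have h2 : (1 : ℝ) ≤ (K ^ 2) ^ 4 := one_le_pow₀ (one_le_pow₀ (by linarith))
      linarith
    refine ⟨_, repeatedTripleTest p ⌈2 / η⌉₊,
      repeatedTripleTest_isOneSidedTester hηpos (Nat.le_ceil _)
        fun f hf => hf.le_toOuterMeasure_pivotSampler hε, ?_⟩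
    have hceil : (⌈2 / η⌉₊ : ℝ) ≤ 3 / η := by
      have h1 := (Nat.ceil_lt_add_one (by positivity : 0 ≤ 2 / η)).le
      have h2 : 1 ≤ 1 / η := by rwa [le_div_iff₀ hηpos, one_mul]
      calc (⌈2 / η⌉₊ : ℝ) ≤ 2 / η + 1 / η := by linarith
        _ = 3 / η := by ring
    calc ((⌈2 / η⌉₊ * 3 : ℕ) : ℝ) ≤ 3 / η * 3 := by push_cast; gcongr
      _ = 288 / ε ^ 3 * K ^ 8 := by rw [hη]; field_simp; ring
      _ ≤ 288 / ε ^ 3 * (5 * Real.log n) ^ 8 := by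
        gcongr
        exact natLog_two_add_two_le hn2
      _ = 288 * 5 ^ 8 / ε ^ 3 * Real.log n ^ 8 := by ring
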